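/- Let $V$ be an oriented $3$-dimensional real vector space with a Lorentzian metric $g_{ab}$ of signature $(+,-,-)$ (for instance a tangent space of an oriented Lorentzian $3$-manifold), with canonical volume form $\eta_{abc}$; indices are raised and lowered with $g$. A rank-2 tensor $T_{ab}$ defines the linear map $k^a\mapsto k^aT_a{}^b$. A Lorentz transformation is a linear map $L$ of $V$ preserving $g$, and it is involutory if $L=L^{-1}$. For a 1-form $\Sigma=\Sigma_{[1]}$ write $\Sigma\cdot\Sigma=\Sigma_a\Sigma^a$, let $(*\Sigma)_{ab}=\eta_{abc}\Sigma^c$ be its Hodge dual, and let $$T_{ab}\{\Sigma_{[1]}\}=\tfrac12\left(\Sigma_a\Sigma_b-(*\Sigma)_{ac}(*\Sigma)_b{}^{c}\right)=\Sigma_a\Sigma_b-\tfrac12(\Sigma\cdot\Sigma)\,g_{ab}$$ be its superenergy tensor. (i) A tensor $T_{ab}$ on $V$ defines a map of the form $cL$, with $c\in\mathbb R\setminus\{0\}$ and $L$ a non-involutory Lorentz transformation, if and only if $$T_{ab}=\beta\, T_{ab}\{\Sigma_{[1]}\}+\alpha\, g_{ab}+\varepsilon\sqrt{2\alpha\beta}\,(*\Sigma)_{ab}$$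 for some $\alpha,\beta\in\mathbb R$ with $\alpha\beta>0$, some sign $\varepsilon\in\{1,-1\}$, and some 1-form $\Sigma\neq0$ with $2\alpha+\beta\,(\Sigma\cdot\Sigma)\neq0$. (ii) For every tensor of the displayed form with $\alpha\beta>0$, $\varepsilon\in\{1,-1\}$ and $\Sigma\ne0$, the map $T_a{}^b$ is non-singular if and only if $2\alpha+\beta\,(\Sigma\cdot\Sigma)\ne0$. In that case, the number of null directions (lines spanned by a non-zero null vector) left invariant by the map is exactly $0$ if $\Sigma$ is timelike ($\Sigma\cdot\Sigma>0$), exactly $1$ if $\Sigma$ is null ($\Sigma\cdot\Sigma=0$), and exactly $2$ if $\Sigma$ is spacelike ($\Sigma\cdot\Sigma<0$). -/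

import Mathlib

/-- A Lorentzian metric `g_ab` of signature `(+,-,…,-)` on an `N`-dimensional real vector space:
a bilinear form that is diagonal with entries `1, -1, …, -1` in some basis. -/
structure LorentzMetric (N : ℕ) [NeZero N] (V : Type*) [AddCommGroup V] [Module ℝ V] where
  /-- The inner product `g_ab x^a y^b`. -/
  form : LinearMap.BilinForm ℝ V
  exists_basis : ∃ e : Module.Basis (Fin N) ℝ V, ∀ i j : Fin N,
    form (e i) (e j) = if i = j then (if i = 0 then 1 else -1) else 0

namespace LorentzMetric

section General

variable {N : ℕ} [NeZero N] {V : Type*} [AddCommGroup V] [Module ℝ V]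

theorem finiteDimensional (g : LorentzMetric N V) : FiniteDimensional ℝ V := by
  obtain ⟨e, -⟩ := g.exists_basis
  exact e.finiteDimensional_of_finite

theorem card_eq_finrank (g : LorentzMetric N V) :
    Fintype.card (Fin N) = Module.finrank ℝ V := by
  obtain ⟨e, -⟩ := g.exists_basis
  exact (Module.finrank_eq_card_basis e).symm

theorem nondegenerate (g : LorentzMetric N V) : g.form.Nondegenerate := by
  obtain ⟨e, he⟩ := g.exists_basis
  have hd : ∀ i, (if i = (0 : Fin N) then (1 : ℝ) else -1) ≠ 0 := by
    intro i; split_ifs <;> norm_num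
  constructor
  · intro x hx
    refine e.ext_elem fun j => ?_
    have h := hx (e j)
    rw [← e.sum_repr x] at h
    simp only [map_sum, map_smul, LinearMap.sum_apply, LinearMap.smul_apply, he, smul_eq_mul,
      mul_ite, mul_zero, Finset.sum_ite_eq', Finset.mem_univ, if_true] at h
    have h' : e.repr x j * (if j = (0 : Fin N) then (1 : ℝ) else -1) = 0 := by
      simpa using h
    simpa using (mul_eq_zero.mp h').resolve_right (hd j)
  · intro x hx
    refine e.ext_elem fun j => ?_
    have h := hx (e j)
    rw [← e.sum_repr x] at h
    simp only [map_sum, map_smul, he, smul_eq_mul,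
      mul_ite, mul_zero, Finset.sum_ite_eq, Finset.mem_univ, if_true] at h
    have h' : e.repr x j * (if j = (0 : Fin N) then (1 : ℝ) else -1) = 0 := by
      simpa using h
    simpa using (mul_eq_zero.mp h').resolve_right (hd j)

/-- Raising an index: `ω_a ↦ ω^a`, the vector with `g_ab ω^a x^b = ω_b x^b` for all `x`. -/
noncomputable def sharp (g : LorentzMetric N V) : Module.Dual ℝ V ≃ₗ[ℝ] V :=
  haveI := g.finiteDimensional
  (g.form.toDual g.nondegenerate).symm

/-- The inner product `ω · θ = g^ab ω_a θ_b` of two 1-forms. -/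
noncomputable def coInner (g : LorentzMetric N V) (ω θ : Module.Dual ℝ V) : ℝ :=
  g.form (g.sharp ω) (g.sharp θ)

/-- The linear map `T_a{}^b : k^a ↦ k^a T_a{}^b` defined by a rank-2 tensor `T_ab`. -/
noncomputable def toMap (g : LorentzMetric N V) (T : LinearMap.BilinForm ℝ V) : V →ₗ[ℝ] V :=
  g.sharp.toLinearMap ∘ₗ T

/-- The product `(T ₂×₂ T)_ab = T_ac T_b{}^c`. -/
noncomputable def sq22 (g : LorentzMetric N V) (T : LinearMap.BilinForm ℝ V) :
    LinearMap.BilinForm ℝ V :=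
  g.form.compl₁₂ (g.toMap T) (g.toMap T)

/-- The canonical volume form `η` of an oriented Lorentzian vector space,
`√|det g_ij| e¹ ∧ … ∧ e^N` in any positively oriented basis. -/
noncomputable def volumeForm (g : LorentzMetric N V) (o : Orientation ℝ V (Fin N)) :
    V [⋀^Fin N]→ₗ[ℝ] ℝ :=
  haveI := g.finiteDimensional
  let b := o.someBasis g.card_eq_finrank
  √|(LinearMap.BilinForm.toMatrix b g.form).det| • b.det

/-- `L` is a Lorentz transformation: a linear isometry of `g`. -/
def IsLorentz (g : LorentzMetric N V) (L : V →ₗ[ℝ] V) : Prop :=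
  ∀ x y : V, g.form (L x) (L y) = g.form x y

/-- The map defined by `T_ab` is a non-zero multiple of a Lorentz transformation `L` which is not
involutory (that is, `L ≠ L⁻¹`, or `L ∘ L ≠ id`). -/
def IsPropNonInvolutoryLorentz (g : LorentzMetric N V) (T : LinearMap.BilinForm ℝ V) : Prop :=
  ∃ (c : ℝ) (L : V →ₗ[ℝ] V), c ≠ 0 ∧ g.IsLorentz L ∧ L ∘ₗ L ≠ LinearMap.id ∧ g.toMap T = c • L

/-- The null directions (lines spanned by a non-zero null vector) that are left invariant by the
map `f`. -/
def invariantNullDirections (g : LorentzMetric N V) (f : V →ₗ[ℝ] V) : Set (Submodule ℝ V) :=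
  {ℓ | (∃ k : V, k ≠ 0 ∧ g.form k k = 0 ∧ ℓ = Submodule.span ℝ {k}) ∧ ℓ.map f = ℓ}

end General

section Three

variable {V : Type*} [AddCommGroup V] [Module ℝ V]

/-- The Hodge dual of a 1-form in three dimensions, `(*ω)_ab = η_abc ω^c`. -/
noncomputable def hodgeDual (g : LorentzMetric 3 V) (o : Orientation ℝ V (Fin 3))
    (ω : Module.Dual ℝ V) : LinearMap.BilinForm ℝ V :=
  LinearMap.mk₂ ℝ (fun x y => g.volumeForm o ![x, y, g.sharp ω])
    (fun x x' y => (g.volumeForm o).map_vecCons_add ![y, g.sharp ω] x x')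
    (fun c x y => (g.volumeForm o).map_vecCons_smul ![y, g.sharp ω] c x)
    (fun x y y' => by
      simpa using ((g.volumeForm o).curryLeft x).map_vecCons_add ![g.sharp ω] y y')
    (fun c x y => by
      simpa using ((g.volumeForm o).curryLeft x).map_vecCons_smul ![g.sharp ω] c y)

/-- The superenergy tensor `T{ω} = ½ (ω ⊙ ω + *ω ⊙ *ω)` of a 1-form in three dimensions. Here
`(A ⊙ A)_ab = (-1)^(p-1)/(p-1)! A_{a c₂…c_p} A_b{}^{c₂…c_p}` for a `p`-form `A`, so that
`(ω ⊙ ω)_ab = ω_a ω_b` and `(*ω ⊙ *ω)_ab = - (*ω)_ac (*ω)_b{}^c`. -/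
noncomputable def superenergy (g : LorentzMetric 3 V) (o : Orientation ℝ V (Fin 3))
    (ω : Module.Dual ℝ V) : LinearMap.BilinForm ℝ V :=
  (1 / 2 : ℝ) • (LinearMap.BilinForm.linMulLin ω ω + -g.sq22 (g.hodgeDual o ω))

end Three

end LorentzMetric

namespace LorentzMetric

/-! ### Index raising, orthonormal coordinates and the volume form. -/

variable {V : Type*} [AddCommGroup V] [Module ℝ V]

/-! Everything is algebra in the skew map J given by `*Σ`, with q = Σ·Σ. It satisfies J² = Σ⊗Σ♯ - q
and J³ = -qJ, so the displayed tensors become F = A + γJ + βJ² with A = α + βq/2 and γ² = 2αβ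
(`toMap_superenergy_add`). The adjoint of F is A - γJ + βJ², and the product of the two collapses to
A² (`form_polynomial`); hence F/A is Lorentz when A ≠ 0, and it is not involutory because γJ ≠ 0.

Conversely, normalise L to determinant 1. Its skew part (L - L⁻¹)/2 is J for some Σ, and
Cayley-Hamilton expresses the symmetric part through J², so L = 1 + J + μJ². The condition L L⁻¹ = 1
reads 2μ = 1 + μ²q, which is exactly γ² = 2αβ (`IsPropNonInvolutoryLorentz.exists_eq`).

A null direction is invariant under a non-singular F iff Σ annihilates it, and J then acts on it by
some m with m² = -q. The sign of q decides the count (`encard_invariantNullDirections`). -/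

theorem form_toMap {N : ℕ} [NeZero N] (g : LorentzMetric N V) (T : LinearMap.BilinForm ℝ V)
    (x y : V) : g.form (g.toMap T x) y = T x y := by
  have := g.finiteDimensional
  simp only [toMap, sharp, LinearMap.comp_apply, LinearEquiv.coe_coe]
  exact LinearMap.BilinForm.apply_toDual_symm_apply (hB := g.nondegenerate) (T x) y

theorem form_sharp {N : ℕ} [NeZero N] (g : LorentzMetric N V) (S : Module.Dual ℝ V)
    (y : V) : g.form (g.sharp S) y = S y := by
  have := g.finiteDimensional
  exact LinearMap.BilinForm.apply_toDual_symm_apply (hB := g.nondegenerate) S y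

theorem ext_form {N : ℕ} [NeZero N] (g : LorentzMetric N V) {x y : V}
    (h : ∀ z, g.form x z = g.form y z) : x = y := by
  rw [← sub_eq_zero]
  exact g.nondegenerate.1 _ fun z => by simp [h z]

theorem form_comm {N : ℕ} [NeZero N] (g : LorentzMetric N V) (x y : V) :
    g.form x y = g.form y x := by
  obtain ⟨e, he⟩ := g.exists_basis
  have h : g.form = g.form.flip := by
    refine e.ext fun i => e.ext fun j => ?_
    change g.form (e i) (e j) = g.form (e j) (e i)
    rw [he, he]
    by_cases hij : i = j
    · subst hij; simp
    · simp [hij, Ne.symm hij]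
  exact LinearMap.congr_fun₂ h x y

/-- Change of basis multiplies the Gram determinant by a square, and it is +1 in signature (+,-,-),
so the absolute value in the volume form is harmless. Only the square is determined because `e` need
not be positively oriented. -/
theorem volumeForm_basis_sq (g : LorentzMetric 3 V) (o : Orientation ℝ V (Fin 3))
    (e : Module.Basis (Fin 3) ℝ V)
    (he : ∀ i j : Fin 3, g.form (e i) (e j) = if i = j then (if i = 0 then 1 else -1) else 0) :
    g.volumeForm o e * g.volumeForm o e = 1 := by
  have := g.finiteDimensional
  set b := o.someBasis g.card_eq_finrank with hb
  have h1 : g.volumeForm o e = √|(LinearMap.BilinForm.toMatrix b g.form).det| * b.det e := by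
    simp [volumeForm, hb]
  have h2 : (LinearMap.BilinForm.toMatrix e g.form).det = 1 := by
    rw [Matrix.det_fin_three]
    simp [LinearMap.BilinForm.toMatrix_apply, he]
  have h3 := LinearMap.BilinForm.toMatrix_mul_basis_toMatrix (b := b) e g.form
  have h4 := congrArg Matrix.det h3
  rw [Matrix.det_mul, Matrix.det_mul, Matrix.det_transpose, h2, ← Module.Basis.det_apply] at h4
  have h5 : (LinearMap.BilinForm.toMatrix b g.form).det * (b.det e * b.det e) = 1 := by
    rw [← h4]; ring
  have h6 : 0 ≤ (LinearMap.BilinForm.toMatrix b g.form).det := by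
    by_contra! h
    nlinarith [mul_self_nonneg (b.det e)]
  rw [h1, abs_of_nonneg h6, mul_mul_mul_comm, Real.mul_self_sqrt h6, h5]

/-- An orthonormal basis puts the metric and the volume form into their standard form, up to the
orientation of the basis. -/
theorem exists_coordinates (g : LorentzMetric 3 V) (o : Orientation ℝ V (Fin 3)) :
    ∃ (e : Module.Basis (Fin 3) ℝ V) (δ : ℝ), δ * δ = 1 ∧
      (∀ i j : Fin 3, g.form (e i) (e j) = if i = j then (if i = 0 then 1 else -1) else 0) ∧
      (∀ x y, g.form x y = e.repr x 0 * e.repr y 0 - e.repr x 1 * e.repr y 1 -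
        e.repr x 2 * e.repr y 2) ∧
      (∀ x y z, g.volumeForm o ![x, y, z] = δ *
        (e.repr x 0 * (e.repr y 1 * e.repr z 2 - e.repr y 2 * e.repr z 1) -
          e.repr x 1 * (e.repr y 0 * e.repr z 2 - e.repr y 2 * e.repr z 0) +
          e.repr x 2 * (e.repr y 0 * e.repr z 1 - e.repr y 1 * e.repr z 0))) := by
  obtain ⟨e, he⟩ := g.exists_basis
  refine ⟨e, g.volumeForm o e, g.volumeForm_basis_sq o e he, he, fun x y => ?_, fun x y z => ?_⟩
  · conv_lhs => rw [← e.sum_repr x, ← e.sum_repr y]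
    simp only [Fin.sum_univ_three, map_add, map_smul, LinearMap.add_apply, LinearMap.smul_apply,
      he, smul_eq_mul]
    simp
    ring
  · rw [(g.volumeForm o).eq_smul_basis_det e]
    simp only [AlternatingMap.smul_apply, Module.Basis.det_self, smul_eq_mul, mul_one]
    rw [Module.Basis.det_apply, Matrix.det_fin_three]
    simp only [Module.Basis.toMatrix_apply, Matrix.cons_val]
    ring

/-! ### The Hodge dual, Lorentz inverses and null vectors. -/

theorem hodgeDual_apply (g : LorentzMetric 3 V) (o : Orientation ℝ V (Fin 3))
    (S : Module.Dual ℝ V) (x y : V) :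
    g.hodgeDual o S x y = g.volumeForm o ![x, y, g.sharp S] := rfl

theorem hodgeDual_swap (g : LorentzMetric 3 V) (o : Orientation ℝ V (Fin 3))
    (S : Module.Dual ℝ V) (x y : V) : g.hodgeDual o S x y = -g.hodgeDual o S y x := by
  obtain ⟨e, δ, -, -, -, hv⟩ := g.exists_coordinates o
  rw [hodgeDual_apply, hodgeDual_apply, hv, hv]
  ring

theorem hodgeDual_sharp (g : LorentzMetric 3 V) (o : Orientation ℝ V (Fin 3))
    (S : Module.Dual ℝ V) (x : V) : g.hodgeDual o S x (g.sharp S) = 0 := by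
  obtain ⟨e, δ, -, -, -, hv⟩ := g.exists_coordinates o
  rw [hodgeDual_apply, hv]
  ring

/-- The contraction identity for two volume forms sharing an index. The orientation sign δ enters
only through δ² = 1. -/
theorem form_toMap_hodgeDual (g : LorentzMetric 3 V) (o : Orientation ℝ V (Fin 3))
    (S : Module.Dual ℝ V) (x y : V) :
    g.form (g.toMap (g.hodgeDual o S) x) (g.toMap (g.hodgeDual o S) y) =
      g.coInner S S * g.form x y - S x * S y := by
  obtain ⟨e, δ, hδ, he, hf, hv⟩ := g.exists_coordinates o
  have key : ∀ (x : V) (i : Fin 3), e.repr (g.toMap (g.hodgeDual o S) x) i =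
      (if i = 0 then 1 else -1) * g.volumeForm o ![x, e i, g.sharp S] := by
    intro (x : V) (i : Fin 3)
    rw [← hodgeDual_apply, ← g.form_toMap, hf]
    fin_cases i <;> simp
  rw [← form_sharp g S x, ← form_sharp g S y, coInner, hf, key, key, key, key, key, key]
  simp only [hf, hv, e.repr_self, Finsupp.single_apply]
  simp
  generalize e.repr x 0 = x0, e.repr x 1 = x1, e.repr x 2 = x2, e.repr y 0 = y0,
    e.repr y 1 = y1, e.repr y 2 = y2, e.repr (g.sharp S) 0 = s0, e.repr (g.sharp S) 1 = s1,
    e.repr (g.sharp S) 2 = s2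
  linear_combination ((s0 * s0 - s1 * s1 - s2 * s2) * (x0 * y0 - x1 * y1 - x2 * y2) -
    (s0 * x0 - s1 * x1 - s2 * x2) * (s0 * y0 - s1 * y1 - s2 * y2)) * hδ

/-- Cayley-Hamilton with one factor of `M` cancelled, valid also for singular `M`; the trace of the
adjugate is the second elementary symmetric function of the eigenvalues. -/
theorem adjugate_fin_three_eq (M : Matrix (Fin 3) (Fin 3) ℝ) :
    M.adjugate = M * M - M.trace • M + M.adjugate.trace • (1 : Matrix (Fin 3) (Fin 3) ℝ) := by
  ext i j
  rw [Matrix.adjugate_fin_three]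
  fin_cases i <;> fin_cases j <;>
    simp [Matrix.mul_apply, Matrix.trace, Fin.sum_univ_three] <;> ring

/-- Every alternating bilinear form is the Hodge dual of a 1-form. -/
theorem exists_hodgeDual_eq (g : LorentzMetric 3 V) (o : Orientation ℝ V (Fin 3))
    (B : LinearMap.BilinForm ℝ V) (hB : ∀ x y, B x y = -B y x) : ∃ S, g.hodgeDual o S = B := by
  obtain ⟨e, δ, hδ, he, hf, hv⟩ := g.exists_coordinates o
  -- The volume form on (e 1, e 2, s) is δ times the 0-component of `s`, and cyclically. No metric
  -- signs appear because `s` is the raised 1-form.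
  set s : V := δ • (B (e 1) (e 2) • e 0 + B (e 2) (e 0) • e 1 + B (e 0) (e 1) • e 2) with hs
  have h0 : ∀ x, B x x = 0 := fun x => by linarith [hB x x]
  refine ⟨g.sharp.symm s, e.ext fun i => e.ext fun j => ?_⟩
  rw [hodgeDual_apply, hv, LinearEquiv.apply_symm_apply, hs]
  have h1 := hB (e 1) (e 0)
  have h2 := hB (e 2) (e 1)
  have h3 := hB (e 0) (e 2)
  fin_cases i <;> fin_cases j <;>
    simp [h0] <;> simp [← mul_assoc, hδ, h1, h2, h3]

/-- Skewness turns J² = 0 into g(Jx, Jx) = 0, that is q g(x,x) = S(x)². A timelike and a spacelike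
basis vector then force q ≥ 0 and q ≤ 0. -/
theorem eq_zero_of_toMap_hodgeDual_sq_eq_zero (g : LorentzMetric 3 V) (o : Orientation ℝ V (Fin 3))
    {S : Module.Dual ℝ V}
    (h : g.toMap (g.hodgeDual o S) * g.toMap (g.hodgeDual o S) = 0) : S = 0 := by
  obtain ⟨e, δ, hδ, he, hf, hv⟩ := g.exists_coordinates o
  have key : ∀ x, g.coInner S S * g.form x x = S x * S x := by
    intro x
    have h1 := g.form_toMap_hodgeDual o S x x
    rw [form_toMap, hodgeDual_swap, ← g.form_toMap, ← Module.End.mul_apply, h] at h1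
    simp at h1
    linarith
  have h0 := key (e 0)
  have h1 := key (e 1)
  have h2 := key (e 2)
  simp [he] at h0 h1 h2
  have hq : g.coInner S S = 0 := by nlinarith [mul_self_nonneg (S (e 0)), mul_self_nonneg (S (e 1))]
  rw [hq] at h0 h1 h2
  refine e.ext fun i => ?_
  fin_cases i <;> simp_all

/-- A Lorentz transformation in three dimensions has an inverse, its adjoint, which is determined by
the Cayley-Hamilton theorem. -/
theorem IsLorentz.exists_inverse (g : LorentzMetric 3 V) {L : Module.End ℝ V}
    (hL : g.IsLorentz L) :
    ∃ (d t : ℝ) (K : Module.End ℝ V), d * d = 1 ∧ L * K = 1 ∧ K * L = 1 ∧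
      (∀ x y, g.form (L x) y = g.form x (K y)) ∧
      L * L - t • L + (d * t) • (1 : Module.End ℝ V) = d • K := by
  have := g.finiteDimensional
  obtain ⟨e, he⟩ := g.exists_basis
  obtain ⟨-, -, -, -, hf, -⟩ := g.exists_coordinates e.orientation
  have hinj : Function.Injective L := by
    refine (injective_iff_map_eq_zero L).2 fun x hx => g.nondegenerate.1 x fun y => ?_
    rw [← hL, hx]; simp
  set E := LinearEquiv.ofInjectiveEndo L hinj with hE
  set K : Module.End ℝ V := E.symm.toLinearMap with hK
  have hLK : L * K = 1 := by
    ext x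
    exact E.apply_symm_apply x
  have hKL : K * L = 1 := by
    ext x
    exact E.symm_apply_apply x
  have hadj : ∀ x y, g.form (L x) y = g.form x (K y) := by
    intro x y
    rw [← hL x (K y), ← Module.End.mul_apply L K, hLK]; rfl
  set M := LinearMap.toMatrix e e L with hM
  set N := LinearMap.toMatrix e e K with hN
  have hrepr : ∀ x i, e.repr x i = (if i = 0 then 1 else -1) * g.form x (e i) := by
    intro x i
    conv_rhs => rw [← e.sum_repr x]
    simp only [Fin.sum_univ_three, map_add, map_smul, LinearMap.add_apply, LinearMap.smul_apply,
      he, smul_eq_mul]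
    fin_cases i <;> simp
  -- The adjoint is the transpose conjugated by diag(1,-1,-1), so it has the same trace and
  -- determinant as `M`.
  have hNM : ∀ i j, N i j = (if i = 0 then 1 else -1) * (if j = 0 then 1 else -1) * M j i := by
    intro i j
    rw [hN, hM, LinearMap.toMatrix_apply, LinearMap.toMatrix_apply, hrepr, hrepr, hadj,
      g.form_comm (e i)]
    split_ifs <;> simp
  have hdet : N.det = M.det := by
    rw [Matrix.det_fin_three, Matrix.det_fin_three]
    simp only [hNM]
    simp
    ring
  have hMN : M * N = 1 := by
    rw [hM, hN, ← LinearMap.toMatrix_mul, hLK, LinearMap.toMatrix_one]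
  have htr : N.trace = M.trace := by
    simp [Matrix.trace, Fin.sum_univ_three, hNM]
  have hd : M.det * M.det = 1 := by
    nth_rewrite 2 [← hdet]
    rw [← Matrix.det_mul, hMN, Matrix.det_one]
  have hadjM : M.adjugate = M.det • N := by
    calc M.adjugate = M.adjugate * (M * N) := by rw [hMN, mul_one]
      _ = M.det • N := by rw [← mul_assoc, Matrix.adjugate_mul]; simp
  refine ⟨M.det, M.trace, K, hd, hLK, hKL, hadj, ?_⟩
  apply (LinearMap.toMatrix e e).injective
  have h := adjugate_fin_three_eq M
  rw [hadjM, Matrix.trace_smul, htr, smul_eq_mul] at h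
  rw [map_add, map_sub, map_smul, map_smul, map_smul, LinearMap.toMatrix_mul,
    LinearMap.toMatrix_one]
  exact h.symm

/-- Subtracting the multiple of `k` with the same time component leaves a null vector with no time
component, and the metric is negative definite on such vectors. -/
theorem eq_smul_of_null_of_orthogonal (g : LorentzMetric 3 V) {k w : V} (hk : k ≠ 0)
    (hkk : g.form k k = 0) (hww : g.form w w = 0) (hwk : g.form w k = 0) :
    ∃ m : ℝ, w = m • k := by
  obtain ⟨e, he⟩ := g.exists_basis
  obtain ⟨e, δ, hδ, he, hf, hv⟩ := g.exists_coordinates e.orientation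
  have hk0 : e.repr k 0 ≠ 0 := by
    intro h0
    rw [hf, h0] at hkk
    refine hk (e.ext_elem fun i => ?_)
    fin_cases i <;> simp <;> nlinarith [mul_self_nonneg (e.repr k 1), mul_self_nonneg (e.repr k 2)]
  refine ⟨e.repr w 0 / e.repr k 0, ?_⟩
  set m := e.repr w 0 / e.repr k 0 with hm
  have hu : g.form (w - m • k) (w - m • k) = 0 := by
    have := g.form_comm k w
    simp [hkk, hww, hwk, this]
  have hu0 : e.repr (w - m • k) 0 = 0 := by
    simp [hm, hk0]
  rw [← sub_eq_zero]
  generalize w - m • k = u at hu hu0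
  rw [hf, hu0] at hu
  refine e.ext_elem fun i => ?_
  fin_cases i <;> simp <;> nlinarith [mul_self_nonneg (e.repr u 1), mul_self_nonneg (e.repr u 2)]

/-! ### Algebra of the skew map of `*S`. -/

section

variable (g : LorentzMetric 3 V) (o : Orientation ℝ V (Fin 3)) (S : Module.Dual ℝ V)

theorem form_toMap_hodgeDual_left (x y : V) :
    g.form (g.toMap (g.hodgeDual o S) x) y = -g.form x (g.toMap (g.hodgeDual o S) y) := by
  rw [g.form_comm x, form_toMap, form_toMap, hodgeDual_swap]

theorem form_toMap_hodgeDual_self (x : V) : g.form (g.toMap (g.hodgeDual o S) x) x = 0 := by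
  have h := g.form_toMap_hodgeDual_left o S x x
  rw [g.form_comm x] at h
  linarith

theorem toMap_hodgeDual_toMap_hodgeDual (x : V) :
    g.toMap (g.hodgeDual o S) (g.toMap (g.hodgeDual o S) x) =
      S x • g.sharp S - g.coInner S S • x := by
  refine g.ext_form fun z => ?_
  rw [form_toMap_hodgeDual_left, form_toMap_hodgeDual]
  simp only [map_sub, map_smul, LinearMap.sub_apply, LinearMap.smul_apply, smul_eq_mul, form_sharp]
  ring

theorem toMap_hodgeDual_sharp : g.toMap (g.hodgeDual o S) (g.sharp S) = 0 := by
  refine g.ext_form fun z => ?_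
  rw [form_toMap_hodgeDual_left, g.form_comm, form_toMap, hodgeDual_sharp]
  simp

theorem apply_toMap_hodgeDual (x : V) : S (g.toMap (g.hodgeDual o S) x) = 0 := by
  rw [← form_sharp g S, g.form_comm, form_toMap_hodgeDual_left, toMap_hodgeDual_sharp]
  simp

theorem apply_sharp : S (g.sharp S) = g.coInner S S := by
  rw [← form_sharp g S, coInner]

theorem toMap_hodgeDual_cube :
    g.toMap (g.hodgeDual o S) * g.toMap (g.hodgeDual o S) * g.toMap (g.hodgeDual o S) =
      -g.coInner S S • g.toMap (g.hodgeDual o S) := by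
  ext x
  simp [Module.End.mul_apply, toMap_hodgeDual_toMap_hodgeDual, toMap_hodgeDual_sharp]

theorem toMap_injective {N : ℕ} [NeZero N] (g : LorentzMetric N V) :
    Function.Injective g.toMap := by
  intro T T' h
  ext x y
  rw [← g.form_toMap T, ← g.form_toMap T', h]

/-- The map defined by `β T{S} + α g + γ *S`, as a polynomial in the map defined by `*S`. -/
theorem toMap_superenergy_add (α β γ : ℝ) :
    g.toMap (β • g.superenergy o S + α • g.form + γ • g.hodgeDual o S) =
      (α + β * g.coInner S S / 2) • (1 : Module.End ℝ V) + γ • g.toMap (g.hodgeDual o S) +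
        β • (g.toMap (g.hodgeDual o S) * g.toMap (g.hodgeDual o S)) := by
  ext x
  refine g.ext_form fun z => ?_
  have h := g.form_toMap_hodgeDual o S x z
  rw [form_toMap]
  simp only [LinearMap.add_apply, LinearMap.smul_apply, Module.End.one_apply, Module.End.mul_apply,
    toMap_hodgeDual_toMap_hodgeDual, map_add, map_sub, map_smul, form_toMap, form_sharp,
    superenergy, sq22, LinearMap.neg_apply, LinearMap.compl₁₂_apply,
    LinearMap.BilinForm.linMulLin_apply, smul_eq_mul, LinearMap.sub_apply]
  rw [← g.form_toMap, h]
  ring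

end

/-! ### The displayed tensors give multiples of Lorentz maps. -/

section

variable {g : LorentzMetric 3 V} {o : Orientation ℝ V (Fin 3)} {S : Module.Dual ℝ V}
  {α β γ A : ℝ} {F : Module.End ℝ V}

theorem form_polynomial (hA : A = α + β * g.coInner S S / 2) (hγ : γ * γ = 2 * α * β)
    (hF : F = A • (1 : Module.End ℝ V) + γ • g.toMap (g.hodgeDual o S) +
      β • (g.toMap (g.hodgeDual o S) * g.toMap (g.hodgeDual o S))) (x y : V) :
    g.form (F x) (F y) = A * A * g.form x y := by
  have h1 := g.form_toMap_hodgeDual_left o S x y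
  have h2 := g.form_toMap_hodgeDual o S x y
  have h3 := g.form_sharp S x
  have h4 : g.form (g.toMap (g.hodgeDual o S) x) (g.sharp S) = 0 := by
    rw [g.form_comm, form_sharp, apply_toMap_hodgeDual]
  have h5 : g.form (g.sharp S) (g.sharp S) = g.coInner S S := rfl
  have h6 := apply_toMap_hodgeDual g o S y
  have h7 := g.form_comm x (g.sharp S)
  rw [hF]
  simp only [LinearMap.add_apply, LinearMap.smul_apply, Module.End.one_apply, Module.End.mul_apply,
    toMap_hodgeDual_toMap_hodgeDual, map_add, map_sub, map_smul, smul_eq_mul, LinearMap.sub_apply,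
    form_sharp, h1, h2, h4, h5, h6, h7, h3]
  generalize g.coInner S S = q at *
  subst hA
  linear_combination (q * g.form x y - S x * S y) * hγ

theorem polynomial_sharp (hF : F = A • (1 : Module.End ℝ V) + γ • g.toMap (g.hodgeDual o S) +
      β • (g.toMap (g.hodgeDual o S) * g.toMap (g.hodgeDual o S))) :
    F (g.sharp S) = A • g.sharp S := by
  rw [hF]
  simp [toMap_hodgeDual_sharp]

/-- The raised 1-form is an eigenvector with eigenvalue `A`, so A = 0 gives a kernel; if A ≠ 0,
scaling a nondegenerate form by A² forces injectivity. -/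
theorem det_polynomial_ne_zero_iff (hS : S ≠ 0) (hA : A = α + β * g.coInner S S / 2)
    (hγ : γ * γ = 2 * α * β)
    (hF : F = A • (1 : Module.End ℝ V) + γ • g.toMap (g.hodgeDual o S) +
      β • (g.toMap (g.hodgeDual o S) * g.toMap (g.hodgeDual o S))) :
    LinearMap.det F ≠ 0 ↔ A ≠ 0 := by
  have := g.finiteDimensional
  rw [← isUnit_iff_ne_zero, LinearMap.isUnit_iff_isUnit_det F |>.symm, LinearMap.isUnit_iff_ker_eq_bot,
    LinearMap.ker_eq_bot]
  constructor
  · rintro h rfl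
    have h1 := polynomial_sharp hF
    rw [zero_smul, ← map_zero F] at h1
    exact hS ((map_eq_zero_iff g.sharp g.sharp.injective).1 (h h1))
  · intro h
    refine (injective_iff_map_eq_zero F).2 fun x hx => g.nondegenerate.1 x fun y => ?_
    have h1 := form_polynomial hA hγ hF x y
    rw [hx] at h1
    simpa [h] using h1.symm

/-- An involutory isometry is self-adjoint, so the skew part γJ would have to vanish. -/
theorem isPropNonInvolutoryLorentz_polynomial (hS : S ≠ 0) (hA : A = α + β * g.coInner S S / 2)
    (hγ : γ * γ = 2 * α * β) (hαβ : 0 < α * β) (hA0 : A ≠ 0) {T : LinearMap.BilinForm ℝ V}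
    (hT : g.toMap T = A • (1 : Module.End ℝ V) + γ • g.toMap (g.hodgeDual o S) +
      β • (g.toMap (g.hodgeDual o S) * g.toMap (g.hodgeDual o S))) :
    g.IsPropNonInvolutoryLorentz T := by
  refine ⟨A, A⁻¹ • g.toMap T, hA0, fun x y => ?_, fun h => hS ?_, by simp [hA0]⟩
  · simp only [LinearMap.smul_apply, map_smul, smul_eq_mul, form_polynomial hA hγ hT]
    field_simp
  · have hγ0 : γ ≠ 0 := by
      rintro rfl
      nlinarith
    have hinv : ∀ x y, g.form (g.toMap T x) y = g.form x (g.toMap T y) := by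
      intro x y
      have h1 := LinearMap.congr_fun h y
      simp only [LinearMap.comp_apply, LinearMap.smul_apply, map_smul, LinearMap.id_apply] at h1
      have h2 : y = (A * A)⁻¹ • g.toMap T (g.toMap T y) := by
        rw [mul_inv, mul_smul, h1]
      conv_lhs => rw [h2]
      rw [map_smul, smul_eq_mul, form_polynomial hA hγ hT]
      field_simp
    refine eq_zero_of_toMap_hodgeDual_sq_eq_zero g o ?_
    have h0 : g.toMap (g.hodgeDual o S) = 0 := by
      ext x
      refine g.ext_form fun y => ?_
      have h1 := hinv x y
      have h2 := g.form_toMap_hodgeDual_left o S x y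
      have h3 := g.form_toMap_hodgeDual_left o S x (g.toMap (g.hodgeDual o S) y)
      have h4 := g.form_toMap_hodgeDual_left o S (g.toMap (g.hodgeDual o S) x) y
      simp only [hT, LinearMap.add_apply, LinearMap.smul_apply, Module.End.one_apply,
        Module.End.mul_apply, map_add, map_smul, smul_eq_mul] at h1
      have h5 : γ * g.form (g.toMap (g.hodgeDual o S) x) y = 0 := by
        rw [h4, h3] at h1
        linear_combination h1 / 2 + γ * h2 / 2
      simpa [hγ0] using h5
    rw [h0, zero_mul]

end

/-! ### From a non-involutory Lorentz map to the superenergy form. -/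

theorem IsPropNonInvolutoryLorentz.exists_unimodular {g : LorentzMetric 3 V}
    {T : LinearMap.BilinForm ℝ V} (hT : g.IsPropNonInvolutoryLorentz T) :
    ∃ (c t : ℝ) (L K : Module.End ℝ V), c ≠ 0 ∧ L ≠ K ∧ L * K = 1 ∧ K * L = 1 ∧
      (∀ x y, g.form (L x) y = g.form x (K y)) ∧
      L * L - t • L + t • (1 : Module.End ℝ V) = K ∧ g.toMap T = c • L := by
  obtain ⟨c, L, hc, hL, hLL, hTL⟩ := hT
  obtain ⟨d, t, K, hd, hLK, hKL, hadj, hCH⟩ := hL.exists_inverse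
  have hd0 : d ≠ 0 := left_ne_zero_of_mul_eq_one hd
  -- In odd dimension, multiplying by the determinant d = ±1 makes the determinant 1; the sign is
  -- absorbed in the constant.
  refine ⟨c * d, d * t, d • L, d • K, mul_ne_zero hc hd0, fun h => hLL ?_, ?_, ?_,
    fun x y => ?_, ?_, ?_⟩
  · have h1 : L = K := smul_right_injective _ hd0 h
    nth_rewrite 2 [h1]
    exact hLK
  · rw [smul_mul_smul_comm, hd, hLK, one_smul]
  · rw [smul_mul_smul_comm, hd, hKL, one_smul]
  · simp [hadj]
  · rw [← hCH, smul_mul_smul_comm, hd, smul_smul, mul_right_comm, hd, one_mul, one_smul]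
  · rw [hTL, smul_smul, mul_assoc, hd, mul_one]

theorem IsPropNonInvolutoryLorentz.exists_eq {g : LorentzMetric 3 V}
    (o : Orientation ℝ V (Fin 3))
    {T : LinearMap.BilinForm ℝ V} (hT : g.IsPropNonInvolutoryLorentz T) :
    ∃ (α β ε : ℝ) (S : Module.Dual ℝ V),
      0 < α * β ∧ (ε = 1 ∨ ε = -1) ∧ S ≠ 0 ∧ 2 * α + β * g.coInner S S ≠ 0 ∧
      T = β • g.superenergy o S + α • g.form + (ε * √(2 * α * β)) • g.hodgeDual o S := by
  obtain ⟨c, t, L, K, hc, hne, hLK, hKL, hadj, hCH, hTL⟩ := hT.exists_unimodular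
  have hadj' : ∀ x y, g.form (K x) y = g.form x (L y) := fun x y => by
    rw [g.form_comm, ← hadj, g.form_comm]
  set B : LinearMap.BilinForm ℝ V := (1 / 2 : ℝ) • (g.form ∘ₗ (L - K)) with hB
  have hBx : ∀ x y, B x y = (1 / 2) * (g.form (L x) y - g.form (K x) y) := fun x y => by
    simp [hB]
  obtain ⟨S, hS⟩ := g.exists_hodgeDual_eq o B fun x y => by
    rw [hBx, hBx, hadj, hadj', g.form_comm x, g.form_comm x]; ring
  have hJ : g.toMap (g.hodgeDual o S) = (1 / 2 : ℝ) • (L - K) := by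
    ext x
    refine g.ext_form fun y => ?_
    rw [form_toMap, hS, hBx]
    simp
  have hS0 : S ≠ 0 := by
    rintro rfl
    have h0 : g.hodgeDual o 0 = 0 := by
      ext x y
      rw [hodgeDual_apply, map_zero]
      exact (g.volumeForm o).map_coord_zero 2 rfl
    have h1 : g.toMap (g.hodgeDual o 0) = 0 := by rw [h0]; simp [toMap]
    rw [hJ, smul_eq_zero_iff_right (by norm_num), sub_eq_zero] at h1
    exact hne h1
  have hcube := g.toMap_hodgeDual_cube o S
  have hsq0 := mt (g.eq_zero_of_toMap_hodgeDual_sq_eq_zero o) hS0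
  set J := g.toMap (g.hodgeDual o S) with hJdef
  set q := g.coInner S S with hq
  have hLL : L * L = t • L - t • (1 : Module.End ℝ V) + K := by rw [← hCH]; module
  have hKK : K * K = t • K - t • (1 : Module.End ℝ V) + L := by
    have h1 : (L * L - t • L + t • (1 : Module.End ℝ V)) * K * K = K * K * K := by rw [hCH]
    have h2 : (L * L - t • L + t • (1 : Module.End ℝ V)) * K = L - t • 1 + t • K := by
      rw [add_mul, sub_mul, mul_assoc, hLK, smul_mul_assoc, smul_mul_assoc, hLK]; simp
    have h3 := h2
    rw [hCH] at h3
    rw [h3]; module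
  have hJJ : J * J = ((t + 1) / 2) • ((1 / 2 : ℝ) • (L + K) - 1) := by
    rw [hJ, smul_mul_smul_comm, sub_mul, mul_sub, mul_sub, hLK, hKL, hLL, hKK]
    module
  -- If t = -1 then J² = 0, so S = 0 and L would equal its inverse.
  have ht : t + 1 ≠ 0 := by
    intro h
    rw [h] at hJJ
    exact hsq0 (by simpa using hJJ)
  set μ := 2 / (t + 1) with hμ
  have hLJ : L = 1 + J + μ • (J * J) := by
    have : μ * ((t + 1) / 2) = 1 := by rw [hμ]; field_simp
    rw [hJJ, smul_smul, this, hJ]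
    module
  have hKJ : K = 1 - J + μ • (J * J) := by
    have : μ * ((t + 1) / 2) = 1 := by rw [hμ]; field_simp
    rw [hJJ, smul_smul, this, hJ]
    module
  have hfour : J * J * J * J = -q • (J * J) := by rw [hcube, smul_mul_assoc]
  have hμq : 2 * μ = 1 + μ ^ 2 * q := by
    have h1 : (2 * μ - 1 - μ ^ 2 * q) • (J * J) = 0 := by
      have h2 : (1 + J + μ • (J * J)) * (1 - J + μ • (J * J)) - 1 =
          (2 * μ - 1) • (J * J) + μ ^ 2 • (J * J * J * J) := by
        simp only [add_mul, mul_add, mul_sub, mul_one, one_mul, smul_mul_assoc, mul_smul_comm,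
          mul_assoc]
        module
      rw [← hLJ, ← hKJ, hLK, sub_self, hfour] at h2
      rw [h2]
      module
    have := (smul_eq_zero.1 h1).resolve_right hsq0
    linarith
  have hsq : 2 * (c - c * μ * q / 2) * (c * μ) = c * c := by linear_combination c ^ 2 * hμq
  have hpos : 0 < c * c := mul_self_pos.2 hc
  -- These come from matching c(1 + J + μJ²) with A + γJ + βJ²: β = cμ, γ = c and α = c - βq/2. Thus
  -- 2αβ = c² and 2α + βq = 2c.
  refine ⟨c - c * μ * q / 2, c * μ, SignType.sign c, S, by nlinarith, ?_, hS0, ?_, ?_⟩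
  · rcases lt_or_gt_of_ne hc with h | h <;> simp [h]
  · intro h
    apply hc
    linarith
  · apply g.toMap_injective
    rw [toMap_superenergy_add, hTL, hsq, Real.sqrt_mul_self_eq_abs, sign_mul_abs, hLJ]
    module

/-! ### Invariant null directions. -/

section

variable {g : LorentzMetric 3 V} {o : Orientation ℝ V (Fin 3)} {S : Module.Dual ℝ V}
  {A β γ : ℝ} {F : Module.End ℝ V}

/-- A null vector annihilated by `S` is an eigenvector of the map defined by `*S`. -/
theorem exists_toMap_hodgeDual_eq_smul (o : Orientation ℝ V (Fin 3)) {k : V} (hk : k ≠ 0)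
    (hkk : g.form k k = 0) (hSk : S k = 0) :
    ∃ m : ℝ, g.toMap (g.hodgeDual o S) k = m • k ∧ m * m = -g.coInner S S := by
  obtain ⟨m, hm⟩ := g.eq_smul_of_null_of_orthogonal hk hkk
    (by rw [form_toMap_hodgeDual, hkk, hSk]; ring) (g.form_toMap_hodgeDual_self o S k)
  refine ⟨m, hm, ?_⟩
  have h := g.toMap_hodgeDual_toMap_hodgeDual o S k
  rw [hm, map_smul, hm, hSk, zero_smul, zero_sub, smul_smul, ← neg_smul] at h
  exact smul_left_injective ℝ hk h

/-- For null `k`, skewness leaves g(Fk, k) = β S(k)², which vanishes on an invariant direction.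
Conversely, if S(k) = 0 then `k` is an eigenvector of J, hence of F, with non-zero eigenvalue by
injectivity. -/
theorem span_mem_invariantNullDirections_iff (hβ : β ≠ 0) (hdet : LinearMap.det F ≠ 0)
    (hF : F = A • (1 : Module.End ℝ V) + γ • g.toMap (g.hodgeDual o S) +
      β • (g.toMap (g.hodgeDual o S) * g.toMap (g.hodgeDual o S)))
    {k : V} (hk : k ≠ 0) (hkk : g.form k k = 0) :
    Submodule.span ℝ {k} ∈ g.invariantNullDirections F ↔ S k = 0 := by
  have := g.finiteDimensional
  have hFk : F k = A • k + γ • g.toMap (g.hodgeDual o S) k +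
      β • (S k • g.sharp S - g.coInner S S • k) := by
    rw [hF, ← toMap_hodgeDual_toMap_hodgeDual]; rfl
  have hinj : Function.Injective F := by
    rw [← LinearMap.ker_eq_bot, ← LinearMap.isUnit_iff_ker_eq_bot,
      LinearMap.isUnit_iff_isUnit_det, isUnit_iff_ne_zero]
    exact hdet
  simp only [invariantNullDirections, Set.mem_ofPred_eq, LinearMap.map_span, Set.image_singleton]
  constructor
  · rintro ⟨-, h⟩
    have h1 : F k ∈ Submodule.span ℝ {k} := h ▸ Submodule.mem_span_singleton_self _
    obtain ⟨l, hl⟩ := Submodule.mem_span_singleton.1 h1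
    have h2 : g.form (F k) k = 0 := by rw [← hl]; simp [hkk]
    rw [hFk] at h2
    simpa [hkk, form_toMap_hodgeDual_self, form_sharp, hβ] using h2
  · intro hSk
    refine ⟨⟨k, hk, hkk, rfl⟩, ?_⟩
    obtain ⟨m, hm, -⟩ := exists_toMap_hodgeDual_eq_smul o hk hkk hSk
    have hl : F k = (A + γ * m - β * g.coInner S S) • k := by
      rw [hFk, hm, hSk]; module
    have hl0 : A + γ * m - β * g.coInner S S ≠ 0 := by
      intro h0
      rw [h0, zero_smul, ← map_zero F] at hl
      exact hk (hinj hl)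
    rw [hl]
    exact Submodule.span_singleton_smul_eq hl0.isUnit k

/-- Since J³ = r²J, any non-zero value of J² + rJ is an eigenvector for `r`. Were all values zero,
J² = -rJ would be both self-adjoint and skew, hence zero. -/
theorem exists_eigenvector (o : Orientation ℝ V (Fin 3)) (hS : S ≠ 0) {r : ℝ} (hr : r ≠ 0)
    (hq : g.coInner S S = -(r * r)) :
    ∃ k : V, k ≠ 0 ∧ g.form k k = 0 ∧ S k = 0 ∧ g.toMap (g.hodgeDual o S) k = r • k := by
  have hsq0 := mt (g.eq_zero_of_toMap_hodgeDual_sq_eq_zero o) hS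
  have hcube := g.toMap_hodgeDual_cube o S
  have hanti := g.form_toMap_hodgeDual_left o S
  have hself := g.form_toMap_hodgeDual_self o S
  have hSJ := g.apply_toMap_hodgeDual o S
  rw [hq, neg_neg] at hcube
  set J := g.toMap (g.hodgeDual o S) with hJ
  obtain ⟨y, hy⟩ : ∃ y, J (J y) + r • J y ≠ 0 := by
    by_contra! h
    have h1 : ∀ y, J (J y) = -(r • J y) := fun y => eq_neg_of_add_eq_zero_left (h y)
    apply hsq0
    ext x
    refine g.ext_form fun z => ?_
    have h2 : g.form (J (J x)) z = g.form x (J (J z)) := by rw [hanti, hanti, neg_neg]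
    rw [h1, h1] at h2
    simp only [map_neg, map_smul, LinearMap.neg_apply, LinearMap.smul_apply, smul_eq_mul,
      hanti] at h2
    have h3 : r * g.form x (J z) = 0 := by linarith
    rw [Module.End.mul_apply, h1]
    simp only [map_neg, map_smul, LinearMap.neg_apply, LinearMap.smul_apply, smul_eq_mul,
      hanti, LinearMap.zero_apply, map_zero]
    linarith
  have hJy : J (J (J y)) = (r * r) • J y := LinearMap.congr_fun hcube y
  have heig : J (J (J y) + r • J y) = r • (J (J y) + r • J y) := by
    rw [map_add, map_smul, hJy]; module
  refine ⟨_, hy, ?_, ?_, heig⟩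
  -- An eigenvector of a skew map with non-zero eigenvalue is null.
  · have h := hself (J (J y) + r • J y)
    rw [heig, map_smul, LinearMap.smul_apply, smul_eq_mul] at h
    exact (mul_eq_zero.1 h).resolve_left hr
  · simp [hSJ]

/-- Skewness makes two eigenvectors with the same non-zero eigenvalue orthogonal, and orthogonal
null vectors are proportional. -/
theorem span_eq_of_eigenvector {r : ℝ} (hr : r ≠ 0) {k k' : V} (hk : k ≠ 0) (hk' : k' ≠ 0)
    (hkk : g.form k k = 0) (hkk' : g.form k' k' = 0)
    (h : g.toMap (g.hodgeDual o S) k = r • k) (h' : g.toMap (g.hodgeDual o S) k' = r • k') :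
    Submodule.span ℝ {k'} = Submodule.span ℝ {k} := by
  have h1 := g.form_toMap_hodgeDual_left o S k' k
  rw [h, h', map_smul, map_smul, LinearMap.smul_apply, smul_eq_mul] at h1
  have h2 : g.form k' k = 0 := by
    have : r * g.form k' k = 0 := by linarith
    exact (mul_eq_zero.1 this).resolve_left hr
  obtain ⟨m, rfl⟩ := g.eq_smul_of_null_of_orthogonal hk hkk hkk' h2
  have hm : m ≠ 0 := by rintro rfl; simp at hk'
  exact Submodule.span_singleton_smul_eq hm.isUnit k

theorem encard_invariantNullDirections (hS : S ≠ 0) (hβ : β ≠ 0) (hdet : LinearMap.det F ≠ 0)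
    (hF : F = A • (1 : Module.End ℝ V) + γ • g.toMap (g.hodgeDual o S) +
      β • (g.toMap (g.hodgeDual o S) * g.toMap (g.hodgeDual o S))) :
    (0 < g.coInner S S → (g.invariantNullDirections F).encard = 0) ∧
      (g.coInner S S = 0 → (g.invariantNullDirections F).encard = 1) ∧
      (g.coInner S S < 0 → (g.invariantNullDirections F).encard = 2) := by
  have hmem := fun {k : V} => span_mem_invariantNullDirections_iff (k := k) hβ hdet hF
  refine ⟨fun hq => ?_, fun hq => ?_, fun hq => ?_⟩
  · rw [Set.encard_eq_zero, Set.eq_empty_iff_forall_notMem]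
    intro l hl
    obtain ⟨⟨k, hk, hkk, rfl⟩, -⟩ := id hl
    obtain ⟨m, -, hm⟩ := exists_toMap_hodgeDual_eq_smul o hk hkk ((hmem hk hkk).1 hl)
    nlinarith [mul_self_nonneg m]
  · have hs : g.sharp S ≠ 0 := fun h => hS ((map_eq_zero_iff g.sharp g.sharp.injective).1 h)
    rw [Set.encard_eq_one]
    refine ⟨Submodule.span ℝ {g.sharp S}, Set.Subset.antisymm ?_ ?_⟩
    · intro l hl
      obtain ⟨⟨k, hk, hkk, rfl⟩, -⟩ := id hl
      obtain ⟨m, rfl⟩ := g.eq_smul_of_null_of_orthogonal hs hq hkk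
        (by rw [g.form_comm, form_sharp, (hmem hk hkk).1 hl])
      have hm : m ≠ 0 := by rintro rfl; simp at hk
      exact Submodule.span_singleton_smul_eq hm.isUnit _
    · rw [Set.singleton_subset_iff]
      exact (hmem hs hq).2 (by rw [apply_sharp, hq])
  · set r := √(-g.coInner S S) with hrdef
    have hr : r ≠ 0 := (Real.sqrt_pos.2 (by linarith)).ne'
    have hrr : r * r = -g.coInner S S := Real.mul_self_sqrt (by linarith)
    -- The two directions are the eigenlines of J for the two square roots ±r of -q.
    obtain ⟨k, hk, hkk, hSk, hJk⟩ := exists_eigenvector o hS hr (by linarith)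
    obtain ⟨n, hn, hnn, hSn, hJn⟩ := exists_eigenvector o hS (neg_ne_zero.2 hr) (by linarith)
    rw [Set.encard_eq_two]
    refine ⟨Submodule.span ℝ {k}, Submodule.span ℝ {n}, fun h => ?_, Set.Subset.antisymm ?_ ?_⟩
    · have h1 : n ∈ Submodule.span ℝ {k} := h ▸ Submodule.mem_span_singleton_self n
      obtain ⟨m, rfl⟩ := Submodule.mem_span_singleton.1 h1
      rw [map_smul, hJk, smul_comm m r k] at hJn
      have h2 := smul_left_injective ℝ hn hJn
      exact hr (by linarith)
    · intro l hl
      obtain ⟨⟨w, hw, hww, rfl⟩, -⟩ := id hl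
      obtain ⟨m, hJw, hm⟩ := exists_toMap_hodgeDual_eq_smul o hw hww ((hmem hw hww).1 hl)
      rw [← hrr, mul_self_eq_mul_self_iff] at hm
      rcases hm with rfl | rfl
      · exact Or.inl (span_eq_of_eigenvector hr hk hw hkk hww hJk hJw)
      · exact Or.inr (span_eq_of_eigenvector (neg_ne_zero.2 hr) hn hw hnn hww hJn hJw)
    · rintro l (rfl | rfl)
      · exact (hmem hk hkk).2 hSk
      · exact (hmem hn hnn).2 hSn

end

end LorentzMetric

theorem mainTheorem12 {V : Type*} [AddCommGroup V] [Module ℝ V]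
    (g : LorentzMetric 3 V) (o : Orientation ℝ V (Fin 3)) :
    -- the maps proportional to non-involutory Lorentz transformations
    (∀ T : LinearMap.BilinForm ℝ V,
      g.IsPropNonInvolutoryLorentz T ↔
        ∃ (α β ε : ℝ) (S : Module.Dual ℝ V),
          0 < α * β ∧ (ε = 1 ∨ ε = -1) ∧ S ≠ 0 ∧ 2 * α + β * g.coInner S S ≠ 0 ∧
          T = β • g.superenergy o S + α • g.form + (ε * √(2 * α * β)) • g.hodgeDual o S) ∧
    -- the excluded case is that of the singular tensors, and the invariant null directions
    (∀ (α β ε : ℝ) (S : Module.Dual ℝ V) (T : LinearMap.BilinForm ℝ V),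
      0 < α * β → (ε = 1 ∨ ε = -1) → S ≠ 0 →
      T = β • g.superenergy o S + α • g.form + (ε * √(2 * α * β)) • g.hodgeDual o S →
        (LinearMap.det (g.toMap T) ≠ 0 ↔ 2 * α + β * g.coInner S S ≠ 0) ∧
        (LinearMap.det (g.toMap T) ≠ 0 →
          (0 < g.coInner S S → (g.invariantNullDirections (g.toMap T)).encard = 0) ∧
          (g.coInner S S = 0 → (g.invariantNullDirections (g.toMap T)).encard = 1) ∧
          (g.coInner S S < 0 → (g.invariantNullDirections (g.toMap T)).encard = 2))) := by
  have main : ∀ (α β ε : ℝ) (S : Module.Dual ℝ V) (T : LinearMap.BilinForm ℝ V),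
      0 < α * β → (ε = 1 ∨ ε = -1) →
      T = β • g.superenergy o S + α • g.form + (ε * √(2 * α * β)) • g.hodgeDual o S →
      (ε * √(2 * α * β)) * (ε * √(2 * α * β)) = 2 * α * β ∧
      g.toMap T = (α + β * g.coInner S S / 2) • (1 : Module.End ℝ V) +
        (ε * √(2 * α * β)) • g.toMap (g.hodgeDual o S) +
        β • (g.toMap (g.hodgeDual o S) * g.toMap (g.hodgeDual o S)) := by
    rintro α β ε S T hαβ hε rfl
    refine ⟨?_, g.toMap_superenergy_add o S α β _⟩
    rw [mul_mul_mul_comm, Real.mul_self_sqrt (by nlinarith)]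
    rcases hε with rfl | rfl <;> ring
  have hA : ∀ (α β q : ℝ), α + β * q / 2 ≠ 0 ↔ 2 * α + β * q ≠ 0 := fun α β q =>
    not_congr ⟨fun h => by linarith, fun h => by linarith⟩
  refine ⟨fun T => ⟨fun h => h.exists_eq o, ?_⟩, fun α β ε S T hαβ hε hS hT => ?_⟩
  · rintro ⟨α, β, ε, S, hαβ, hε, hS, hne, hT⟩
    obtain ⟨hγ, hF⟩ := main α β ε S T hαβ hε hT
    exact LorentzMetric.isPropNonInvolutoryLorentz_polynomial hS rfl hγ hαβ ((hA _ _ _).2 hne) hF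
  · obtain ⟨hγ, hF⟩ := main α β ε S T hαβ hε hT
    exact ⟨(LorentzMetric.det_polynomial_ne_zero_iff hS rfl hγ hF).trans (hA _ _ _), fun hdet =>
      LorentzMetric.encard_invariantNullDirections hS (right_ne_zero_of_mul hαβ.ne') hdet hF⟩
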